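/- Let $k$ be a field and let $X$ be the oriented graph with vertices $[p]$, $p\ge 0$, and edges $\varepsilon_p^i:[p-1]\to[p]$ ($p>0$, $0\le i\le p$) and $\eta_q^j:[q+1]\to[q]$ ($q\ge 0$, $0\le j\le q$). Let $C(X)$ be the free category on $X$, whose morphisms are the words (paths, including the empty words $1_{[p]}$, written so that the edge passed last stands leftmost), and let $kC(X)$ be the partial algebra of $k$-linear combinations of words with common source and common target. Let $S\subset kC(X)$ be the set of the polynomials $u-v$ for the following relations $u=v$: \begin{align*} f_{q+1,q}:&\quad \varepsilon_{q+1}^i\varepsilon_q^{j-1}=\varepsilon_{q+1}^j\varepsilon_q^i\quad (j>i),\\ g_{q,q+1}:&\quad \eta_q^j\eta_{q+1}^i=\eta_q^i\eta_{q+1}^{j+1}\quad (j\ge i),\\ h_{q-1,q}:&\quad \eta_{q-1}^j\varepsilon_q^i=\begin{cases}\varepsilon_{q-1}^i\eta_{q-2}^{j-1}, & j>i,\\ 1_{[q-1]}, & i=j\text{ or }i=j+1,\\ \varepsilon_{q-1}^{i-1}\eta_{q-2}^j, & i>j+1.\end{cases} \end{align*} Order the $\eta$'s, and likewise the $\varepsilon$'s,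 by $\eta_p^i>\eta_q^j$ iff $p>q$, or $p=q$ and $i<j$. Order the words $\eta_{p_1}^{i_1}\cdots\eta_{p_n}^{i_n}$ in the $\eta$'s by comparing $(n,\eta_{p_n}^{i_n},\dots,\eta_{p_1}^{i_1})$ lexicographically (all empty words being equal here). For $u=v_0\varepsilon_{p_1}^{i_1}v_1\cdots\varepsilon_{p_n}^{i_n}v_n\in C(X)$, where the $v_t$ are words in the $\eta$'s, put $wt(u)=(n,v_0,\dots,v_n,\varepsilon_{p_1}^{i_1},\dots,\varepsilon_{p_n}^{i_n})$. Let $u\succ_1 v$ iff $wt(u)>wt(v)$ lexicographically, or $u=1_{[p]}$, $v=1_{[q]}$ with $p>q$. A monomial order is a well ordering $>$ of the set of all words such that $u>v$ implies $uw>vw$ and $wu>wv$ whenever these products are defined; $\bar f$ denotes the leading (largest) word of a nonzero $f\in kC(X)$. For polynomials $f,g$ with leading coefficient $1$ and words $a,b$, a composition with respect to a word $w$ is $(f,g)_w=f-agb$ if $w=\bar f=a\bar g b$ (inclusion), and $(f,g)_w=fb-ag$ if $w=\bar f b=a\bar g$ (intersection). A nonempty set $S$ of polynomials with leading coefficient $1$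 is a Gröbner–Shirshov basis in $kC(X)$ if every composition $(f,g)_w$ with $f,g\in S$ is a linear combination $\sum_i\alpha_i a_is_ib_i$ with $\alpha_i\in k$, $s_i\in S$, words $a_i,b_i$, and $a_i\bar s_i b_i<w$. Let $Irr(S)$ be the set of all words that are not of the form $a\bar s b$ with $s\in S$ and words $a,b$. Theorem. The order $\succ_1$ is a monomial order on $C(X)$, and with respect to it $S$ is a Gröbner–Shirshov basis in $kC(X)$. Moreover, the words in $Irr(S)$ from $[q]$ to $[p]$ are exactly the words $$\varepsilon_p^{i_1}\cdots\varepsilon_{p-m+1}^{i_m}\,\eta_{q-n}^{j_1}\cdots\eta_{q-1}^{j_n},\qquad p\ge i_1>\dots>i_m\ge 0,\quad 0\le j_1<\dots<j_n<q,\quad q-n+m=p,$$ and $Irr(S)$ is a linear basis of the quotient $kC(X)/Id(S)$ of $kC(X)$ by the ideal $Id(S)$ generated by $S$, and of the category partial algebra $kC(X|S)$ of the category $C(X|S)$ generated by $X$ with defining relations $S$: for any two vertices, the classes of the words of $Irr(S)$ with this source and target are distinct and form a basis of the corresponding $k$-vector space of the quotient. -/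

import Mathlib

open CategoryTheory

universe w u v

namespace GSCat

/-! ### Category partial algebras, ideals

Composition convention: a product of words `x y` of the literature (apply `y` first, then `x`) is
`y ≫ x` here. For a category `C`, the category partial algebra over `k` is Mathlib's
`CategoryTheory.Free k C`: its morphisms from `a` to `b` are the finite `k`-linear combinations of
morphisms `a ⟶ b` of `C`, multiplied by bilinear extension of composition. -/

section Algebra

variable (k : Type w) [Field k] {C : Type u} [Category.{v} C]

/-- The polynomials of the category partial algebra `kC` with domain `a` and codomain `b`. -/
abbrev Poly (a b : C) : Type (max v w) := Free.of k a ⟶ Free.of k b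

/-- A morphism of `C`, as an element of `kC` (with coefficient `1`). -/
noncomputable abbrev mono {a b : C} (x : a ⟶ b) : Poly k a b := (Free.embedding k C).map x

variable {k}

/-- The coefficients of a polynomial. -/
def coeff {a b : C} (f : Poly k a b) : (a ⟶ b) →₀ k := f

/-- A two-sided ideal of the partial algebra `kC`: a subspace of every space of polynomials with
fixed domain and codomain, stable under all products that are defined. -/
def IsIdeal (I : ∀ a b : C, Submodule k (Poly k a b)) : Prop :=
  (∀ (a b c : C) (f : Poly k a b) (g : Poly k b c), f ∈ I a b → f ≫ g ∈ I a c) ∧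
  (∀ (a b c : C) (f : Poly k a b) (g : Poly k b c), g ∈ I b c → f ≫ g ∈ I a c)

/-- `Id(S)`, the ideal of `kC` generated by `S`: the intersection of all ideals containing `S`. -/
noncomputable def idealGen (S : ∀ a b : C, Set (Poly k a b)) (a b : C) : Submodule k (Poly k a b) :=
  ⨅ (I : ∀ a b : C, Submodule k (Poly k a b)) (_ : IsIdeal I)
    (_ : ∀ a b, S a b ⊆ (I a b : Set (Poly k a b))), I a b

/-- A set `B` of vectors of a `k`-vector space, given as the values of `e` on a set `s` of indices,
is a linear basis. -/
def IsLinearBasis {ι M : Type*} [AddCommGroup M] [Module k M] (s : Set ι) (e : ι → M) : Prop :=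
  LinearIndependent k (fun x : s => e x) ∧ Submodule.span k (e '' s) = ⊤

variable (k) in
/-- The relations `x = y` of a category, written as the polynomials `x - y`. -/
def relPoly (r : HomRel C) (a b : C) : Set (Poly k a b) :=
  {f | ∃ x y : a ⟶ b, r x y ∧ f = mono k x - mono k y}

end Algebra

/-! ### Gröbner–Shirshov bases in the free category partial algebra `kC(X)` of a graph `X` -/

section GS

variable {V : Type u} [Quiver.{v} V]

variable (V) in
/-- The words (paths, including the empty ones) of the graph `V`: all morphisms of the free
category `Paths V`. -/
structure Word where
  /-- the source -/
  src : Paths V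
  /-- the target -/
  tgt : Paths V
  /-- the path -/
  path : src ⟶ tgt

/-- A path, as a word. -/
def toWord {a b : Paths V} (x : a ⟶ b) : Word V := ⟨a, b, x⟩

/-- `lt` (read `lt x y` as `x < y`) is a monomial order: a well ordering of all words such that
`x < y` implies `x z < y z` and `z x < z y` whenever these products are defined. -/
def IsMonomialOrder (lt : Word V → Word V → Prop) : Prop :=
  IsWellOrder (Word V) lt ∧
  (∀ (a b c d : Paths V) (x : b ⟶ c) (y : b ⟶ d) (z : a ⟶ b),
    lt (toWord x) (toWord y) → lt (toWord (z ≫ x)) (toWord (z ≫ y))) ∧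
  (∀ (a b c d : Paths V) (x : a ⟶ c) (y : b ⟶ c) (z : c ⟶ d),
    lt (toWord x) (toWord y) → lt (toWord (x ≫ z)) (toWord (y ≫ z)))

variable {k : Type w} [Field k]

/-- `x` is the leading term of `f`. -/
def IsLeading (lt : Word V → Word V → Prop) {a b : Paths V} (f : Poly k a b) (x : a ⟶ b) : Prop :=
  coeff f x ≠ 0 ∧ ∀ y : a ⟶ b, coeff f y ≠ 0 → y ≠ x → lt (toWord y) (toWord x)

/-- The polynomial `f` is nonzero with leading coefficient `1`. -/
def IsMonic (lt : Word V → Word V → Prop) {a b : Paths V} (f : Poly k a b) : Prop :=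
  ∃ x : a ⟶ b, IsLeading lt f x ∧ coeff f x = 1

/-- `p ≡ q mod (S, W)`: the difference is a linear combination of `S`-words `x s y` with
`x s̄ y < W`, where `s̄` is the leading term of `s`. -/
def EquivMod (lt : Word V → Word V → Prop) (S : ∀ a b : Paths V, Set (Poly k a b)) (W : Word V)
    {a b : Paths V} (p q : Poly k a b) : Prop :=
  p - q ∈ Submodule.span k {f : Poly k a b |
    ∃ (c d : Paths V) (s : Poly k c d) (l : c ⟶ d) (y : a ⟶ c) (x : d ⟶ b),
      s ∈ S c d ∧ IsLeading lt s l ∧ lt (toWord (y ≫ l ≫ x)) W ∧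
      f = mono k y ≫ s ≫ mono k x}

/-- `S` is a Gröbner–Shirshov basis in `kC(X)`: a nonempty set of monic polynomials all of whose
compositions of inclusion (`W = f̄ = x ḡ y`, composition `f - x g y`) and of intersection
(`W = f̄ y = x ḡ`, composition `f y - x g`) are trivial modulo `(S, W)`. -/
def IsGroebnerShirshovBasis (lt : Word V → Word V → Prop)
    (S : ∀ a b : Paths V, Set (Poly k a b)) : Prop :=
  (∃ (a b : Paths V) (f : Poly k a b), f ∈ S a b) ∧
  (∀ (a b : Paths V) (f : Poly k a b), f ∈ S a b → IsMonic lt f) ∧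
  (∀ (a b c d : Paths V) (f : Poly k a b) (g : Poly k c d) (lf : a ⟶ b) (lg : c ⟶ d)
    (y : a ⟶ c) (x : d ⟶ b), f ∈ S a b → g ∈ S c d → IsLeading lt f lf → IsLeading lt g lg →
    lf = y ≫ lg ≫ x →
    EquivMod lt S (toWord lf) (f - mono k y ≫ g ≫ mono k x) 0) ∧
  (∀ (a b c d : Paths V) (f : Poly k c b) (g : Poly k a d) (lf : c ⟶ b) (lg : a ⟶ d)
    (y : a ⟶ c) (x : d ⟶ b), f ∈ S c b → g ∈ S a d → IsLeading lt f lf → IsLeading lt g lg →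
    y ≫ lf = lg ≫ x →
    EquivMod lt S (toWord (y ≫ lf)) (mono k y ≫ f - g ≫ mono k x) 0)

/-- `Irr(S)`, its part with source `a` and target `b`: the words that are not of the form
`x s̄ y` with `s ∈ S`. -/
def Irr (lt : Word V → Word V → Prop) (S : ∀ a b : Paths V, Set (Poly k a b)) (a b : Paths V) :
    Set (a ⟶ b) :=
  {z | ¬ ∃ (c d : Paths V) (s : Poly k c d) (l : c ⟶ d) (y : a ⟶ c) (x : d ⟶ b),
    s ∈ S c d ∧ IsLeading lt s l ∧ z = y ≫ l ≫ x}

end GS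

/-! ### The graph and the relations of the simplicial category -/

/-- The vertices `[p]`, `p ≥ 0`. -/
structure Vertex where
  /-- the number `p` of the vertex `[p]` -/
  dim : ℕ

/-- The edges: `face p i` is `ε_{p+1}^i : [p] → [p+1]` (`0 ≤ i ≤ p+1`), and
`degen q j` is `η_q^j : [q+1] → [q]` (`0 ≤ j ≤ q`). -/
inductive Edge : Vertex → Vertex → Type
  | face (p : ℕ) (i : Fin (p + 2)) : Edge ⟨p⟩ ⟨p + 1⟩
  | degen (q : ℕ) (j : Fin (q + 1)) : Edge ⟨q + 1⟩ ⟨q⟩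

instance : Quiver Vertex := ⟨Edge⟩

/-- The vertex `[p]` as an object of the free category. -/
def obj (p : ℕ) : Paths Vertex := (⟨p⟩ : Vertex)

/-- `ε_{p+1}^i` as a word of length one. -/
def eps (p : ℕ) (i : Fin (p + 2)) : obj p ⟶ obj (p + 1) :=
  (Paths.of Vertex).map (Edge.face p i : (⟨p⟩ : Vertex) ⟶ ⟨p + 1⟩)

/-- `η_q^j` as a word of length one. -/
def eta (q : ℕ) (j : Fin (q + 1)) : obj (q + 1) ⟶ obj q :=
  (Paths.of Vertex).map (Edge.degen q j : (⟨q + 1⟩ : Vertex) ⟶ ⟨q⟩)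

/-- The simplicial identities, with the indices shifted so that no subtraction occurs.
* `f`: `ε_{p+2}^i ε_{p+1}^j = ε_{p+2}^{j+1} ε_{p+1}^i` for `i ≤ j`;
* `g`: `η_q^j η_{q+1}^i = η_q^i η_{q+1}^{j+1}` for `i ≤ j`;
* `h_lt`: `η_{n+1}^{j+1} ε_{n+2}^i = ε_{n+1}^i η_n^j` for `i < j + 1`;
* `h_eq`, `h_succ`: `η_n^j ε_{n+1}^i = 1` for `i = j` and for `i = j + 1`;
* `h_gt`: `η_{n+1}^j ε_{n+2}^{i+1} = ε_{n+1}^i η_n^j` for `i + 1 > j + 1`. -/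
inductive Rel : HomRel (Paths Vertex)
  | f (p : ℕ) (i j : Fin (p + 2)) (hij : i ≤ j) :
      Rel (eps p j ≫ eps (p + 1) i.castSucc) (eps p i ≫ eps (p + 1) j.succ)
  | g (q : ℕ) (i j : Fin (q + 1)) (hij : i ≤ j) :
      Rel (eta (q + 1) i.castSucc ≫ eta q j) (eta (q + 1) j.succ ≫ eta q i)
  | h_lt (n : ℕ) (i : Fin (n + 2)) (j : Fin (n + 1)) (hij : i ≤ j.castSucc) :
      Rel (eps (n + 1) i.castSucc ≫ eta (n + 1) j.succ) (eta n j ≫ eps n i)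
  | h_eq (n : ℕ) (j : Fin (n + 1)) : Rel (eps n j.castSucc ≫ eta n j) (𝟙 (obj n))
  | h_succ (n : ℕ) (j : Fin (n + 1)) : Rel (eps n j.succ ≫ eta n j) (𝟙 (obj n))
  | h_gt (n : ℕ) (i : Fin (n + 2)) (j : Fin (n + 1)) (hij : j.castSucc < i) :
      Rel (eps (n + 1) i.succ ≫ eta (n + 1) j.castSucc) (eta n j ≫ eps n i)

/-! ### The order on words -/

/-- A letter: `face p i` is `ε_p^i`, and `degen q j` is `η_q^j`. -/
inductive Letter
  | face (p i : ℕ) : Letter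
  | degen (q j : ℕ) : Letter

/-- The letter of an edge. -/
def Edge.letter : {a b : Vertex} → Edge a b → Letter
  | _, _, .face p i => .face (p + 1) i
  | _, _, .degen q j => .degen q j

/-- The letters of a path, from left to right as the word is written, so that the edge that is
passed last comes first. -/
def pathLetters {a : Vertex} : {b : Vertex} → Quiver.Path a b → List Letter
  | _, .nil => []
  | _, .cons x e => Edge.letter e :: pathLetters x

/-- The letters of a morphism of the free category. -/
def letters {a b : Paths Vertex} (x : a ⟶ b) : List Letter := pathLetters x

/-- For `x = v₀ ε_{p₁}^{i₁} v₁ ⋯ ε_{pₙ}^{iₙ} vₙ`, where the `v_t` are words in the `η`'s, the list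
`[v₀, …, vₙ]`; a word `v_t` is the list of the pairs `(q, j)` of its letters `η_q^j`. -/
def etaBlocks : List Letter → List (List (ℕ × ℕ))
  | [] => [[]]
  | .face _ _ :: l => [] :: etaBlocks l
  | .degen q j :: l => (etaBlocks l).modifyHead (List.cons (q, j))

/-- For `x = v₀ ε_{p₁}^{i₁} v₁ ⋯ ε_{pₙ}^{iₙ} vₙ`, the list `[(p₁, i₁), …, (pₙ, iₙ)]`. -/
def faces : List Letter → List (ℕ × ℕ)
  | [] => []
  | .face p i :: l => (p, i) :: faces l
  | .degen _ _ :: l => faces l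

/-- The order of the generators of one kind: `(p, i) < (q, j)` iff `p < q`, or `p = q` and
`i > j`. -/
def genLT (x y : ℕ × ℕ) : Prop := x.1 < y.1 ∨ (x.1 = y.1 ∧ y.2 < x.2)

/-- The order of the words in the `η`'s: first by length, then lexicographically from the right. -/
def etaWordLT (x y : List (ℕ × ℕ)) : Prop :=
  x.length < y.length ∨ (x.length = y.length ∧ List.Lex genLT x.reverse y.reverse)

/-- The order `≺₁`: words `x = v₀ ε_{p₁}^{i₁} v₁ ⋯ ε_{pₙ}^{iₙ} vₙ` are compared lexicographically
by the weights `(n, v₀, …, vₙ, ε_{p₁}^{i₁}, …, ε_{pₙ}^{iₙ})`. Words with equal weights are equal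
unless both are empty; the empty words `1_{[p]}` are ordered by `p`. -/
def simplicialLT (x y : Word Vertex) : Prop :=
  let l := letters x.path
  let m := letters y.path
  (faces l).length < (faces m).length ∨
  ((faces l).length = (faces m).length ∧
    (List.Lex etaWordLT (etaBlocks l) (etaBlocks m) ∨
    (etaBlocks l = etaBlocks m ∧
      (List.Lex genLT (faces l) (faces m) ∨
      (faces l = faces m ∧ Vertex.dim x.tgt < Vertex.dim y.tgt)))))

/-- The words `ε_p^{i₁} ⋯ ε_{p-m+1}^{i_m} η_{q-n}^{j₁} ⋯ η_{q-1}^{j_n}` with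
`p ≥ i₁ > ⋯ > i_m ≥ 0`, `0 ≤ j₁ < ⋯ < j_n < q` and `q - n + m = p`, as lists of letters;
`r = q - n = p - m`. -/
def normalForms (q p : ℕ) : Set (List Letter) :=
  {L | ∃ (r m n : ℕ) (i : Fin m → ℕ) (j : Fin n → ℕ), q = r + n ∧ p = r + m ∧
    StrictAnti i ∧ (∀ t, i t ≤ p) ∧ StrictMono j ∧ (∀ t, j t < q) ∧
    L = List.ofFn (fun t : Fin m => Letter.face (p - t) (i t)) ++
      List.ofFn (fun t : Fin n => Letter.degen (q - n + t) (j t))}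

end GSCat

open GSCat

namespace GSCat

/-! ### Lexicographic comparison of lists -/

/-! No composition is resolved by hand. Each defining relation `x = y` strictly lowers `≺₁`, so
rewriting left-hand sides into right-hand sides terminates at a word without reducible adjacent
letters (`exists_normal_reflTransGen`). Confluence comes from an invariant: forget the dimensions
and let words act on `ℕ`, with `ε^i` the increasing injection that misses only `i` and `η^j` the
monotone surjection that identifies only `j` and `j + 1`. Both sides of every relation act alike.

Every left-hand side has length two, and neighbouring letters of a path have matching dimensions, so
irreducibility is a condition on adjacent indices alone. It forces all `ε`'s to stand left of all
`η`'s, with decreasing and increasing indices respectively. Such a word can be recovered from its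
action: the upper indices of its `ε`'s are the values missed, and those of its `η`'s are the `n` for
which `n` and `n + 1` have the same image. With source and target fixed, the action thus determines
the irreducible word (`eq_of_act_letters_eq`).

In a composition with respect to `w` the two copies of `w` cancel. What remains is a difference of
two words below `w` with the same action; both descend, staying below `w`, to one irreducible word,
so the composition is trivial. For the bases, termination gives spanning. Independence holds because
the action extends linearly to a map into the monoid algebra of self-maps of `ℕ` that kills the
ideal and sends irreducible words to distinct basis elements; in the category `C(X|S)` the action
separates the classes directly. -/

theorem lex_of_forall_mem {α : Type*} {r s : α → α → Prop} {l m : List α} (h : List.Lex r l m) :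
    (∀ a ∈ l, ∀ b ∈ m, r a b → s a b) → List.Lex s l m := by
  induction h with
  | nil => intro _; exact .nil
  | cons _ ih =>
    intro H
    exact .cons (ih fun a ha b hb => H a (by simp [ha]) b (by simp [hb]))
  | rel h => intro H; exact .rel (H _ (by simp) _ (by simp) h)

theorem lex_append_cases {α : Type*} {r : α → α → Prop} :
    ∀ {l m l' m' : List α}, l.length = m.length → List.Lex r (l ++ l') (m ++ m') →
      List.Lex r l m ∨ (l = m ∧ List.Lex r l' m')
  | [], [], _, _, _, h => .inr ⟨rfl, h⟩
  | a :: l, b :: m, _, _, hl, h => by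
    cases h with
    | cons h =>
      rcases lex_append_cases (l := l) (m := m) (by simpa using hl) h with h' | ⟨h', h''⟩
      · exact .inl (.cons h')
      · exact .inr ⟨by rw [h'], h''⟩
    | rel h => exact .inl (.rel h)

theorem lex_append_of_lex {α : Type*} {r : α → α → Prop} {l m : List α} (h : List.Lex r l m) :
    ∀ (l' m' : List α), l.length = m.length → List.Lex r (l ++ l') (m ++ m') := by
  induction h with
  | nil => intro _ _ h; simp at h
  | cons _ ih => intro l' m' h; exact .cons (ih _ _ (by simpa using h))
  | rel h => intro _ _ _; exact .rel h

/-! ### Letters of words -/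

theorem pathLetters_comp {a b c : Vertex} (x : Quiver.Path a b) (y : Quiver.Path b c) :
    pathLetters (x.comp y) = pathLetters y ++ pathLetters x := by
  induction y with
  | nil => rfl
  | cons y e ih => simp [pathLetters, ih]

@[simp]
theorem letters_comp {a b c : Paths Vertex} (x : a ⟶ b) (y : b ⟶ c) :
    letters (x ≫ y) = letters y ++ letters x :=
  pathLetters_comp x y

@[simp]
theorem letters_id (a : Paths Vertex) : letters (𝟙 a) = [] := rfl

@[simp]
theorem letters_eps (p : ℕ) (i : Fin (p + 2)) : letters (eps p i) = [.face (p + 1) i] := rfl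

@[simp]
theorem letters_eta (q : ℕ) (j : Fin (q + 1)) : letters (eta q j) = [.degen q j] := rfl

/-- A letter determines its edge together with both endpoints, so `b = d` only serves to tell the
empty words apart. -/
theorem word_eq_of_pathLetters_eq {a b : Vertex} (x : Quiver.Path a b) :
    ∀ {c d : Vertex} (y : Quiver.Path c d), pathLetters x = pathLetters y → b = d →
      (⟨a, b, x⟩ : Word Vertex) = ⟨c, d, y⟩ := by
  induction x with
  | nil =>
    intro c d y h hd
    cases y with
    | nil => subst hd; rfl
    | cons y e => simp [pathLetters] at h
  | cons x e ih =>
    intro c d y h hd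
    cases y with
    | nil => simp [pathLetters] at h
    | cons y e' =>
      simp only [pathLetters, List.cons.injEq] at h
      obtain ⟨he, h⟩ := h
      change Edge _ _ at e e'
      cases e <;> cases e' <;> simp [Edge.letter] at he
      · obtain ⟨rfl, he⟩ := he
        obtain rfl := Fin.ext he
        have := ih y h rfl
        cases this
        rfl
      · obtain ⟨rfl, he⟩ := he
        obtain rfl := Fin.ext he
        have := ih y h rfl
        cases this
        rfl

theorem letters_injective {a b : Paths Vertex} :
    Function.Injective (letters : (a ⟶ b) → List Letter) := by
  intro x y h
  have := word_eq_of_pathLetters_eq (a := a) (b := b) x (c := a) (d := b) y h rfl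
  cases this
  rfl

/-- The index of a letter does not exceed its dimension. -/
def Letter.Valid : Letter → Prop
  | .face p i => i ≤ p
  | .degen q j => j ≤ q

theorem valid_of_mem_pathLetters {a b : Vertex} (x : Quiver.Path a b) :
    ∀ c ∈ pathLetters x, c.Valid := by
  induction x with
  | nil => simp [pathLetters]
  | cons x e ih =>
    intro c hc
    simp only [pathLetters, List.mem_cons] at hc
    rcases hc with rfl | hc
    · change Edge _ _ at e
      cases e with
      | face p i => simpa [Edge.letter, Letter.Valid] using Nat.lt_succ_iff.mp i.2
      | degen q j => simpa [Edge.letter, Letter.Valid] using Nat.lt_succ_iff.mp j.2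
    · exact ih c hc

/-! ### Weights -/

theorem exists_etaBlocks_eq_cons (l : List Letter) : ∃ v B, etaBlocks l = v :: B := by
  induction l with
  | nil => exact ⟨_, _, rfl⟩
  | cons c l ih =>
    obtain ⟨v, B, h⟩ := ih
    cases c <;> simp [etaBlocks, h]

theorem length_etaBlocks (l : List Letter) : (etaBlocks l).length = (faces l).length + 1 := by
  induction l with
  | nil => rfl
  | cons c l ih => cases c <;> simp [etaBlocks, faces, ih]

theorem eq_of_etaBlocks_eq_of_faces_eq :
    ∀ {l m : List Letter}, etaBlocks l = etaBlocks m → faces l = faces m → l = m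
  | [], [], _, _ => rfl
  | [], .face p i :: m, _, h => by simp [faces] at h
  | [], .degen q j :: m, h, _ => by
    obtain ⟨v, B, hB⟩ := exists_etaBlocks_eq_cons m
    simp [etaBlocks, hB] at h
  | .face p i :: l, [], _, h => by simp [faces] at h
  | .degen q j :: l, [], h, _ => by
    obtain ⟨v, B, hB⟩ := exists_etaBlocks_eq_cons l
    simp [etaBlocks, hB] at h
  | .face p i :: l, .face p' i' :: m, h, h' => by
    simp only [etaBlocks, faces, List.cons.injEq, Prod.mk.injEq, true_and] at h h'
    obtain ⟨⟨rfl, rfl⟩, h'⟩ := h'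
    rw [eq_of_etaBlocks_eq_of_faces_eq h h']
  | .face p i :: l, .degen q j :: m, h, _ => by
    obtain ⟨v, B, hB⟩ := exists_etaBlocks_eq_cons m
    simp [etaBlocks, hB] at h
  | .degen q j :: l, .face p i :: m, h, _ => by
    obtain ⟨v, B, hB⟩ := exists_etaBlocks_eq_cons l
    simp [etaBlocks, hB] at h
  | .degen q j :: l, .degen q' j' :: m, h, h' => by
    obtain ⟨v, B, hB⟩ := exists_etaBlocks_eq_cons l
    obtain ⟨v', B', hB'⟩ := exists_etaBlocks_eq_cons m
    simp only [etaBlocks, faces, hB, hB', List.modifyHead_cons, List.cons.injEq,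
      Prod.mk.injEq] at h h'
    obtain ⟨⟨⟨rfl, rfl⟩, rfl⟩, rfl⟩ := h
    rw [eq_of_etaBlocks_eq_of_faces_eq (hB.trans hB'.symm) h']

theorem le_of_mem_faces {l : List Letter} (h : ∀ c ∈ l, c.Valid) :
    ∀ c ∈ faces l, c.2 ≤ c.1 := by
  induction l with
  | nil => simp [faces]
  | cons c l ih =>
    have ih := ih fun d hd => h d (by simp [hd])
    have hc := h c (by simp)
    cases c with
    | face p i =>
      intro d hd
      simp only [faces, List.mem_cons] at hd
      rcases hd with rfl | hd
      · exact hc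
      · exact ih d hd
    | degen q j => exact ih

theorem le_of_mem_etaBlocks {l : List Letter} (h : ∀ c ∈ l, c.Valid) :
    ∀ v ∈ etaBlocks l, ∀ c ∈ v, c.2 ≤ c.1 := by
  induction l with
  | nil => simp [etaBlocks]
  | cons c l ih =>
    have ih := ih fun d hd => h d (by simp [hd])
    have hc := h c (by simp)
    cases c with
    | face p i =>
      intro v hv
      simp only [etaBlocks, List.mem_cons] at hv
      rcases hv with rfl | hv
      · simp
      · exact ih v hv
    | degen q j =>
      obtain ⟨v, B, hB⟩ := exists_etaBlocks_eq_cons l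
      rw [hB] at ih
      simp only [etaBlocks, hB, List.modifyHead_cons]
      intro v' hv' d hd
      rcases List.mem_cons.1 hv' with rfl | hv'
      · rcases List.mem_cons.1 hd with rfl | hd
        · exact hc
        · exact ih v (by simp) d hd
      · exact ih v' (by simp [hv']) d hd

/-! ### The order on words is a well order -/

instance : Std.Trichotomous genLT :=
  ⟨fun ⟨a, b⟩ ⟨c, d⟩ h h' => by
    simp only [genLT] at h h'
    ext <;> simp <;> omega⟩

instance : Std.Trichotomous etaWordLT :=
  ⟨fun a b h h' => by
    have key : ¬ List.Shortlex genLT a.reverse b.reverse := by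
      simpa [List.shortlex_def, etaWordLT] using h
    have key' : ¬ List.Shortlex genLT b.reverse a.reverse := by
      simpa [List.shortlex_def, etaWordLT] using h'
    exact List.reverse_injective (Std.Trichotomous.trichotomous _ _ key key')⟩

/-- A well-founded version of `genLT`, equal to it on the indices of valid letters. -/
def genLTAux : ℕ × ℕ → ℕ × ℕ → Prop :=
  InvImage (Prod.Lex (· < ·) (· < ·)) fun x => (x.1, x.1 - x.2)

theorem genLTAux_wf : WellFounded genLTAux :=
  InvImage.wf _ (WellFounded.prod_lex Nat.lt_wfRel.wf Nat.lt_wfRel.wf)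

theorem genLTAux_of_genLT {x y : ℕ × ℕ} (hx : x.2 ≤ x.1) (h : genLT x y) : genLTAux x y := by
  refine Prod.lex_def.2 ?_
  rcases h with h | ⟨h, h'⟩
  · exact .inl h
  · exact .inr ⟨h, by simp only; omega⟩

theorem shortlex_genLTAux_of_etaWordLT {v v' : List (ℕ × ℕ)} (hv : ∀ c ∈ v, c.2 ≤ c.1)
    (h : etaWordLT v v') : List.Shortlex genLTAux v.reverse v'.reverse := by
  refine List.shortlex_def.2 ?_
  rcases h with h | ⟨h, h'⟩
  · exact .inl (by simpa using h)
  · exact .inr ⟨by simpa using h, lex_of_forall_mem h' fun a ha b _ hab =>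
      genLTAux_of_genLT (hv a (by simpa using ha)) hab⟩

/-- A well-founded relation on weights that contains the order of the weights of words. -/
def weightLTAux :
    ℕ × List (List (ℕ × ℕ)) × List (ℕ × ℕ) × ℕ → ℕ × List (List (ℕ × ℕ)) × List (ℕ × ℕ) × ℕ →
      Prop :=
  Prod.Lex (· < ·) (Prod.Lex
    (List.Shortlex (InvImage (List.Shortlex genLTAux) List.reverse))
    (Prod.Lex (List.Shortlex genLTAux) (· < ·)))

theorem weightLTAux_wf : WellFounded weightLTAux :=
  WellFounded.prod_lex Nat.lt_wfRel.wf (WellFounded.prod_lex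
    (List.Shortlex.wf (InvImage.wf _ (List.Shortlex.wf genLTAux_wf)))
    (WellFounded.prod_lex (List.Shortlex.wf genLTAux_wf) Nat.lt_wfRel.wf))

/-- The weight of a word. -/
def weight (x : Word Vertex) : ℕ × List (List (ℕ × ℕ)) × List (ℕ × ℕ) × ℕ :=
  ((faces (letters x.path)).length, etaBlocks (letters x.path), faces (letters x.path),
    Vertex.dim x.tgt)

/-- Two sources of infinite descent have to be excluded. Lexicographic comparison of lists is not
well founded in general, but the number of `ε`'s is compared first and fixes the number of blocks,
so only lists of equal length meet and `List.Shortlex` applies. The relation `genLT` descends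
forever as the upper index grows, but a letter of a word has index at most its dimension, where `p -
i` measures the descent. -/
theorem weightLTAux_of_simplicialLT {x y : Word Vertex} (h : simplicialLT x y) :
    weightLTAux (weight x) (weight y) := by
  have hv := valid_of_mem_pathLetters x.path
  simp only [weightLTAux, Prod.lex_def, weight]
  rcases h with h | ⟨h, h' | ⟨h', h'' | h''⟩⟩
  · exact .inl h
  · refine .inr ⟨h, .inl (List.Shortlex.of_lex ?_ ?_)⟩
    · rw [length_etaBlocks, length_etaBlocks, h]
    · exact lex_of_forall_mem h' fun a ha b _ hab =>
        shortlex_genLTAux_of_etaWordLT (le_of_mem_etaBlocks hv a ha) hab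
  · refine .inr ⟨h, .inr ⟨h', .inl (List.Shortlex.of_lex h ?_)⟩⟩
    exact lex_of_forall_mem h'' fun a ha b _ hab => genLTAux_of_genLT (le_of_mem_faces hv a ha) hab
  · exact .inr ⟨h, .inr ⟨h', .inr h''⟩⟩

theorem simplicialLT_wf : WellFounded simplicialLT :=
  Subrelation.wf (fun h => weightLTAux_of_simplicialLT h) (InvImage.wf weight weightLTAux_wf)

instance : IsWellOrder (Word Vertex) simplicialLT where
  wf := simplicialLT_wf
  trichotomous x y h h' := by
    simp only [simplicialLT, not_or, not_and] at h h'
    have h1 : (faces (letters x.path)).length = (faces (letters y.path)).length := by omega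
    obtain ⟨h2, h⟩ := h.2 h1
    obtain ⟨h2', h'⟩ := h'.2 h1.symm
    have h3 := Std.Trichotomous.trichotomous _ _ h2 h2'
    obtain ⟨h4, h⟩ := h h3
    obtain ⟨h4', h'⟩ := h' h3.symm
    have h5 := Std.Trichotomous.trichotomous _ _ h4 h4'
    have h6 : Vertex.dim x.tgt = Vertex.dim y.tgt := by
      have := h h5
      have := h' h5.symm
      omega
    exact word_eq_of_pathLetters_eq x.path y.path (eq_of_etaBlocks_eq_of_faces_eq h3 h5)
      (congrArg Vertex.mk h6)

/-! ### Compatibility of the order with products -/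

/-- The order of the weights of lists of letters. -/
def lettersLT (l m : List Letter) : Prop :=
  (faces l).length < (faces m).length ∨
  ((faces l).length = (faces m).length ∧
    (List.Lex etaWordLT (etaBlocks l) (etaBlocks m) ∨
    (etaBlocks l = etaBlocks m ∧ List.Lex genLT (faces l) (faces m))))

theorem simplicialLT_iff {x y : Word Vertex} :
    simplicialLT x y ↔ lettersLT (letters x.path) (letters y.path) ∨
      (letters x.path = letters y.path ∧ Vertex.dim x.tgt < Vertex.dim y.tgt) := by
  constructor
  · rintro (h | ⟨h, h' | ⟨h', h'' | ⟨h'', h3⟩⟩⟩)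
    · exact .inl (.inl h)
    · exact .inl (.inr ⟨h, .inl h'⟩)
    · exact .inl (.inr ⟨h, .inr ⟨h', h''⟩⟩)
    · exact .inr ⟨eq_of_etaBlocks_eq_of_faces_eq h' h'', h3⟩
  · rintro ((h | ⟨h, h' | ⟨h', h''⟩⟩) | ⟨h, h'⟩)
    · exact .inl h
    · exact .inr ⟨h, .inl h'⟩
    · exact .inr ⟨h, .inr ⟨h', .inl h''⟩⟩
    · exact .inr ⟨by rw [h], .inr ⟨by rw [h], .inr ⟨by rw [h], h'⟩⟩⟩

/-- Words are read from the right, so a letter added on the left is compared last. It cannot disturb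
the comparison because the lengths already agree when the lexicographic clause is used. -/
theorem etaWordLT_cons {v v' : List (ℕ × ℕ)} (h : etaWordLT v v') (c : ℕ × ℕ) :
    etaWordLT (c :: v) (c :: v') := by
  rcases h with h | ⟨h, h'⟩
  · exact .inl (by simpa using h)
  · refine .inr ⟨by simpa using h, ?_⟩
    rw [List.reverse_cons, List.reverse_cons]
    exact lex_append_of_lex h' _ _ (by simpa using h)

theorem etaWordLT_concat {v v' : List (ℕ × ℕ)} (h : etaWordLT v v') (c : ℕ × ℕ) :
    etaWordLT (v ++ [c]) (v' ++ [c]) := by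
  rcases h with h | ⟨h, h'⟩
  · exact .inl (by simpa using h)
  · exact .inr ⟨by simpa using h, by simpa using List.Lex.cons h'⟩

theorem lettersLT_cons {l m : List Letter} (h : lettersLT l m) (c : Letter) :
    lettersLT (c :: l) (c :: m) := by
  cases c with
  | face p i =>
    rcases h with h | ⟨h, h' | ⟨h', h''⟩⟩
    · exact .inl (by simpa [faces] using h)
    · exact .inr ⟨by simpa [faces] using h, .inl (.cons h')⟩
    · exact .inr ⟨by simpa [faces] using h, .inr ⟨by simp [etaBlocks, h'], .cons h''⟩⟩
  | degen q j =>
    rcases h with h | ⟨h, h' | ⟨h', h''⟩⟩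
    · exact .inl h
    · refine .inr ⟨h, .inl ?_⟩
      obtain ⟨v, B, hB⟩ := exists_etaBlocks_eq_cons l
      obtain ⟨v', B', hB'⟩ := exists_etaBlocks_eq_cons m
      simp only [etaBlocks, hB, hB', List.modifyHead_cons] at h' ⊢
      cases h' with
      | cons h' => exact .cons h'
      | rel h' => exact .rel (etaWordLT_cons h' _)
    · exact .inr ⟨h, .inr ⟨by simp [etaBlocks, h'], h''⟩⟩

theorem faces_append (l m : List Letter) : faces (l ++ m) = faces l ++ faces m := by
  induction l with
  | nil => rfl
  | cons c l ih => cases c <;> simp [faces, ih]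

theorem etaBlocks_concat_face (l : List Letter) (p i : ℕ) :
    etaBlocks (l ++ [.face p i]) = etaBlocks l ++ [[]] := by
  induction l with
  | nil => rfl
  | cons c l ih =>
    obtain ⟨v, B, hB⟩ := exists_etaBlocks_eq_cons l
    cases c <;> simp [etaBlocks, ih, hB]

/-- The blocks are computed from the left. This describes multiplication by an `η` on the right,
which touches only the last block. -/
theorem exists_etaBlocks_concat_degen (l : List Letter) :
    ∃ A v, etaBlocks l = A ++ [v] ∧
      ∀ q j, etaBlocks (l ++ [.degen q j]) = A ++ [v ++ [(q, j)]] := by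
  induction l with
  | nil => exact ⟨[], [], rfl, fun _ _ => rfl⟩
  | cons c l ih =>
    obtain ⟨A, v, h, h'⟩ := ih
    cases c with
    | face p i => exact ⟨[] :: A, v, by simp [etaBlocks, h], by simp [etaBlocks, h']⟩
    | degen q j =>
      cases A with
      | nil => exact ⟨[], (q, j) :: v, by simp [etaBlocks, h], by simp [etaBlocks, h']⟩
      | cons w A => exact ⟨((q, j) :: w) :: A, v, by simp [etaBlocks, h], by simp [etaBlocks, h']⟩

theorem lettersLT_concat {l m : List Letter} (h : lettersLT l m) (c : Letter) :
    lettersLT (l ++ [c]) (m ++ [c]) := by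
  have hlen (h : (faces l).length = (faces m).length) :
      (etaBlocks l).length = (etaBlocks m).length := by
    rw [length_etaBlocks, length_etaBlocks, h]
  simp only [lettersLT, faces_append, List.length_append, add_lt_add_iff_right, add_left_inj]
  rcases h with h | ⟨h, h'⟩
  · exact .inl h
  refine .inr ⟨h, ?_⟩
  cases c with
  | face p i =>
    rw [etaBlocks_concat_face, etaBlocks_concat_face]
    rcases h' with h' | ⟨h', h''⟩
    · exact .inl (lex_append_of_lex h' _ _ (hlen h))
    · exact .inr ⟨by rw [h'], lex_append_of_lex h'' _ _ h⟩
  | degen q j =>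
    obtain ⟨A, v, hA, hA'⟩ := exists_etaBlocks_concat_degen l
    obtain ⟨B, v', hB, hB'⟩ := exists_etaBlocks_concat_degen m
    rw [hA', hB']
    rw [hA, hB] at h'
    have hAB : A.length = B.length := by simpa [hA, hB] using hlen h
    rcases h' with h' | ⟨h', h''⟩
    · left
      rcases lex_append_cases (l := A) (m := B) hAB h' with h' | ⟨rfl, h''⟩
      · exact lex_append_of_lex h' _ _ hAB
      · cases h'' with
        | cons h' => cases h'
        | rel h' => exact List.Lex.append_left _ (.rel (etaWordLT_concat h' _)) _
    · refine .inr ⟨?_, lex_append_of_lex h'' _ _ h⟩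
      obtain ⟨rfl, hv⟩ := List.append_inj h' hAB
      obtain rfl : v = v' := by simpa using hv
      rfl

theorem lettersLT_append_left {l m : List Letter} (h : lettersLT l m) (t : List Letter) :
    lettersLT (t ++ l) (t ++ m) := by
  induction t with
  | nil => exact h
  | cons c t ih => exact lettersLT_cons ih c

theorem lettersLT_append_right (t : List Letter) :
    ∀ {l m : List Letter}, lettersLT l m → lettersLT (l ++ t) (m ++ t) := by
  induction t with
  | nil => intro l m h; simpa using h
  | cons c t ih => intro l m h; simpa using ih (lettersLT_concat h c)

/-- With a common source the tie-break by target never decides: empty words coincide, and for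
nonempty words the first letter fixes the target. -/
theorem lettersLT_of_simplicialLT {a b c : Paths Vertex} {x : a ⟶ b} {y : a ⟶ c}
    (h : simplicialLT (toWord x) (toWord y)) : lettersLT (letters x) (letters y) := by
  rcases simplicialLT_iff.1 h with h | ⟨h, h'⟩
  · exact h
  · have h : pathLetters (a := a) (b := b) x = pathLetters (a := a) (b := c) y := h
    change Quiver.Path (V := Vertex) a b at x
    change Quiver.Path (V := Vertex) a c at y
    cases x with
    | nil =>
      cases y with
      | nil => simp [toWord] at h'
      | cons y e => simp [pathLetters] at h
    | cons x e =>
      cases y with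
      | nil => simp [pathLetters] at h
      | cons y e' =>
        simp only [pathLetters, List.cons.injEq] at h
        obtain ⟨he, h⟩ := h
        change Edge _ _ at e e'
        cases e <;> cases e' <;> simp [Edge.letter] at he <;> simp [toWord, he.1] at h'

theorem simplicialLT_isMonomialOrder : IsMonomialOrder simplicialLT := by
  refine ⟨inferInstance, ?_, ?_⟩
  · intro a b c d x y z h
    refine simplicialLT_iff.2 (.inl ?_)
    have := lettersLT_append_right (letters z) (lettersLT_of_simplicialLT h)
    simpa [toWord] using this
  · intro a b c d x y z h
    rcases simplicialLT_iff.1 h with h | ⟨h, h'⟩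
    · refine simplicialLT_iff.2 (.inl ?_)
      have := lettersLT_append_left h (letters z)
      simpa [toWord] using this
    -- Here the targets agree, so the tie-break would read `dim c < dim c`.
    · simp [toWord] at h'

/-! ### The action of words on the natural numbers -/

/-- The action of a letter on `ℕ`: `ε^i` skips the value `i`, and `η^j` takes the value `j`
twice. -/
def Letter.act : Letter → ℕ → ℕ
  | .face _ i, n => if n < i then n else n + 1
  | .degen _ j, n => if n ≤ j then n else n - 1

/-- The action of a list of letters, the last of which acts first. -/
def act : List Letter → ℕ → ℕ
  | [] => id
  | c :: l => c.act ∘ act l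

theorem act_append (l m : List Letter) : act (l ++ m) = act l ∘ act m := by
  induction l with
  | nil => rfl
  | cons c l ih => simp [act, ih, Function.comp_assoc]

theorem act_letters_eq_of_rel {a b : Paths Vertex} {x y : a ⟶ b} (h : Rel x y) :
    act (letters x) = act (letters y) := by
  cases h <;> funext n <;>
    simp_all only [letters_comp, letters_eps, letters_eta, letters_id, List.cons_append,
      List.nil_append, act, Letter.act, Function.comp_apply, id, Fin.val_castSucc, Fin.val_succ,
      Fin.le_def, Fin.lt_def] <;>
    (repeat' split) <;> omega

theorem act_letters_eq_of_compClosure {a b : Paths Vertex} {x y : a ⟶ b}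
    (h : HomRel.CompClosure Rel x y) : act (letters x) = act (letters y) := by
  cases h with
  | intro _ _ f m₁ m₂ g h => simp [act_append, act_letters_eq_of_rel h]

theorem act_letters_eq_of_reflTransGen {a b : Paths Vertex} {x y : a ⟶ b}
    (h : Relation.ReflTransGen (@HomRel.CompClosure _ _ Rel a b) x y) :
    act (letters x) = act (letters y) := by
  induction h with
  | refl => rfl
  | tail _ h ih => exact ih.trans (act_letters_eq_of_compClosure h)

/-! ### Reducible words -/

/-- `c d` is the left-hand side of a defining relation, up to the dimensions of the letters. -/
def Letter.Reducible : Letter → Letter → Prop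
  | .face _ i, .face _ j => i ≤ j
  | .face _ _, .degen _ _ => False
  | .degen _ _, .face _ _ => True
  | .degen _ j, .degen _ i => i ≤ j

/-- No two adjacent letters form the left-hand side of a defining relation. -/
def Normal (l : List Letter) : Prop := l.IsChain fun c d => ¬ c.Reducible d

theorem exists_letters_eq_of_rel {a b : Paths Vertex} {x y : a ⟶ b} (h : Rel x y) :
    ∃ c d, letters x = [c, d] ∧ c.Reducible d := by
  cases h with
  | f p i j hij => exact ⟨_, _, rfl, hij⟩
  | g q i j hij => exact ⟨_, _, rfl, hij⟩
  | h_lt n i j hij => exact ⟨_, _, rfl, trivial⟩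
  | h_eq n j => exact ⟨_, _, rfl, trivial⟩
  | h_succ n j => exact ⟨_, _, rfl, trivial⟩
  | h_gt n i j hij => exact ⟨_, _, rfl, trivial⟩

/-- In `f` and `g` the first letters compared have equal dimension, and the larger index `j + 1` is
the smaller letter. In `h_lt` and `h_gt` the `η` leaves the block `v₀`, which becomes empty. In
`h_eq` and `h_succ` an `ε` disappears. -/
theorem lettersLT_of_rel {a b : Paths Vertex} {x y : a ⟶ b} (h : Rel x y) :
    lettersLT (letters y) (letters x) := by
  cases h with
  | f p i j hij =>
    refine .inr ⟨rfl, .inr ⟨rfl, .rel (.inr ⟨rfl, ?_⟩)⟩⟩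
    have := Fin.le_def.1 hij
    simpa using Nat.lt_succ_of_le this
  | g q i j hij =>
    refine .inr ⟨rfl, .inl (.rel (.inr ⟨rfl, .rel (.inr ⟨rfl, ?_⟩)⟩))⟩
    have := Fin.le_def.1 hij
    simpa using Nat.lt_succ_of_le this
  | h_lt n i j hij => exact .inr ⟨rfl, .inl (.rel (.inl Nat.zero_lt_one))⟩
  | h_eq n j => exact .inl Nat.zero_lt_one
  | h_succ n j => exact .inl Nat.zero_lt_one
  | h_gt n i j hij => exact .inr ⟨rfl, .inl (.rel (.inl Nat.zero_lt_one))⟩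

theorem simplicialLT_of_rel {a b : Paths Vertex} {x y : a ⟶ b} (h : Rel x y) :
    simplicialLT (toWord y) (toWord x) :=
  simplicialLT_iff.2 (.inl (lettersLT_of_rel h))

theorem simplicialLT_comp_comp {a b c d : Paths Vertex} {x y : b ⟶ c}
    (h : simplicialLT (toWord x) (toWord y)) (f : a ⟶ b) (g : c ⟶ d) :
    simplicialLT (toWord (f ≫ x ≫ g)) (toWord (f ≫ y ≫ g)) :=
  simplicialLT_isMonomialOrder.2.1 _ _ _ _ _ _ f
    (simplicialLT_isMonomialOrder.2.2 _ _ _ _ _ _ g h)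

theorem simplicialLT_of_compClosure {a b : Paths Vertex} {x y : a ⟶ b}
    (h : HomRel.CompClosure Rel x y) : simplicialLT (toWord y) (toWord x) := by
  cases h with
  | intro _ _ f m₁ m₂ g h => exact simplicialLT_comp_comp (simplicialLT_of_rel h) f g

theorem exists_rel_of_reducible {a b c : Vertex} (e : Edge a b) (e' : Edge b c)
    (h : e'.letter.Reducible e.letter) :
    ∃ y, Rel ((Paths.of Vertex).map (e : a ⟶ b) ≫ (Paths.of Vertex).map (e' : b ⟶ c)) y := by
  cases e with
  | face p j =>
    cases e' with
    | face _ i =>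
      have hij : (i : ℕ) ≤ j := h
      have hi : (i : ℕ) < p + 2 := by omega
      exact ⟨_, Rel.f p ⟨i, hi⟩ j hij⟩
    | degen _ i =>
      rcases lt_trichotomy (j : ℕ) i with hji | hji | hji
      -- The relation `h_lt` lives in positive dimension; `p = 0` is impossible since `j < i ≤ p`.
      · obtain _ | n := p
        · omega
        obtain ⟨i, rfl⟩ := Fin.exists_succ_eq.2 (show i ≠ 0 by rintro rfl; simp at hji)
        have hj : (j : ℕ) < n + 2 := by omega
        exact ⟨_, Rel.h_lt n ⟨j, hj⟩ i (by simpa [Fin.le_def, Nat.lt_succ_iff] using hji)⟩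
      · obtain rfl : j = Fin.castSucc i := Fin.ext hji
        exact ⟨_, Rel.h_eq p i⟩
      · by_cases hji' : (j : ℕ) = i + 1
        · obtain rfl : j = i.succ := Fin.ext hji'
          exact ⟨_, Rel.h_succ p i⟩
        obtain _ | n := p
        · have := j.2
          omega
        obtain ⟨j, rfl⟩ := Fin.exists_succ_eq.2 (show j ≠ 0 by rintro rfl; simp at hji)
        simp only [Fin.val_succ] at hji hji'
        have hj := j.2
        have hi : (i : ℕ) < n + 1 := by omega
        refine ⟨_, Rel.h_gt n j ⟨i, hi⟩ ?_⟩
        simp only [Fin.lt_def, Fin.val_castSucc]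
        omega
  | degen q j =>
    cases e' with
    | face _ i => exact h.elim
    | degen q i =>
      have hij : (j : ℕ) ≤ i := h
      have hj : (j : ℕ) < q + 1 := by omega
      exact ⟨_, Rel.g q ⟨j, hj⟩ i hij⟩

/-- Induction on the path: either the path without its last edge can already be rewritten, or the
offending pair consists of the two edges passed last. -/
theorem exists_compClosure_of_not_normal {a b : Vertex} (z : Quiver.Path a b)
    (h : ¬ Normal (pathLetters z)) :
    ∃ z' : Quiver.Path a b, @HomRel.CompClosure (Paths Vertex) _ Rel a b z z' := by
  induction z with
  | nil => exact (h .nil).elim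
  | cons z e' ih =>
    by_cases hz : Normal (pathLetters z)
    · cases z with
      | nil => exact (h (.singleton _)).elim
      | cons z e =>
        have hr : (Edge.letter e').Reducible (Edge.letter e) := by
          by_contra hr
          exact h (.cons_cons hr hz)
        obtain ⟨y, hy⟩ := exists_rel_of_reducible e e' hr
        exact ⟨_, @HomRel.CompClosure.intro (Paths Vertex) _ Rel a _ _ _ z _ _ (𝟙 _) hy⟩
    · obtain ⟨z', hz'⟩ := ih hz
      exact ⟨_, @HomRel.IsStableUnderPostcomp.comp_right (Paths Vertex) _ (HomRel.CompClosure Rel) _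
        a _ _ _ _ ((Paths.of Vertex).map e') hz'⟩

theorem not_normal_of_compClosure {a b : Paths Vertex} {x y : a ⟶ b}
    (h : HomRel.CompClosure Rel x y) : ¬ Normal (letters x) := by
  cases h with
  | intro _ _ f m₁ m₂ g h =>
    obtain ⟨c, d, hcd, hr⟩ := exists_letters_eq_of_rel h
    intro hn
    have hn' : List.IsChain (fun c d => ¬ Letter.Reducible c d) [c, d] :=
      hn.infix ⟨letters g, letters f, by simp [hcd]⟩
    simp at hn'
    exact hn' hr

theorem normal_letters_iff {a b : Paths Vertex} {x : a ⟶ b} :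
    Normal (letters x) ↔ ∀ y : a ⟶ b, ¬ HomRel.CompClosure Rel x y := by
  refine ⟨fun h y hy => not_normal_of_compClosure hy h, fun h => ?_⟩
  by_contra hn
  obtain ⟨y, hy⟩ := exists_compClosure_of_not_normal (a := a) (b := b) x hn
  exact h y hy

theorem exists_normal_reflTransGen {a b : Paths Vertex} (x : a ⟶ b) :
    ∃ y, Normal (letters y) ∧ Relation.ReflTransGen (@HomRel.CompClosure _ _ Rel a b) x y := by
  induction x using (InvImage.wf toWord simplicialLT_wf).induction with
  | h x ih =>
    by_cases hx : Normal (letters x)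
    · exact ⟨x, hx, .refl⟩
    · obtain ⟨y, hy⟩ := exists_compClosure_of_not_normal (a := a) (b := b) x hx
      obtain ⟨z, hz, hyz⟩ := ih y (simplicialLT_of_compClosure hy)
      exact ⟨z, hz, .head hy hyz⟩

/-! ### The shape of irreducible words -/

/-- The word `ε_p^{i₁} ε_{p-1}^{i₂} ⋯`. -/
def faceLetters : ℕ → List ℕ → List Letter
  | _, [] => []
  | p, i :: I => .face p i :: faceLetters (p - 1) I

/-- The word `η_r^{j₁} η_{r+1}^{j₂} ⋯`. -/
def degenLetters : ℕ → List ℕ → List Letter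
  | _, [] => []
  | r, j :: J => .degen r j :: degenLetters (r + 1) J

theorem faceLetters_eq_ofFn (p : ℕ) (I : List ℕ) :
    faceLetters p I = List.ofFn fun t : Fin I.length => Letter.face (p - t) (I.get t) := by
  induction I generalizing p with
  | nil => rfl
  | cons i I ih => simp [faceLetters, ih, List.ofFn_succ, Nat.sub_sub, Nat.add_comm]

theorem degenLetters_eq_ofFn (r : ℕ) (J : List ℕ) :
    degenLetters r J = List.ofFn fun t : Fin J.length => Letter.degen (r + t) (J.get t) := by
  induction J generalizing r with
  | nil => rfl
  | cons j J ih => simp [degenLetters, ih, List.ofFn_succ, Nat.add_assoc, Nat.add_comm 1]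

theorem normal_degenLetters {J : List ℕ} (hJ : J.IsChain (· < ·)) (r : ℕ) :
    Normal (degenLetters r J) := by
  induction J generalizing r with
  | nil => exact .nil
  | cons j J ih =>
    have ih := ih hJ.tail (r + 1)
    cases J with
    | nil => exact .singleton _
    | cons j' J =>
      rw [List.isChain_cons_cons] at hJ
      exact .cons_cons (by simpa [Letter.Reducible] using hJ.1) ih

theorem normal_faceLetters_append_degenLetters {I J : List ℕ} (hI : I.IsChain (· > ·))
    (hJ : J.IsChain (· < ·)) (p r : ℕ) : Normal (faceLetters p I ++ degenLetters r J) := by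
  induction I generalizing p with
  | nil => exact normal_degenLetters hJ r
  | cons i I ih =>
    have ih := ih hI.tail (p - 1)
    cases I with
    | nil =>
      cases J with
      | nil => exact .singleton _
      | cons j J => exact .cons_cons (by simp [Letter.Reducible]) ih
    | cons i' I =>
      rw [List.isChain_cons_cons] at hI
      exact .cons_cons (by simpa [Letter.Reducible] using hI.1) ih

/-- An `η` directly to the left of an `ε` is always reducible, so once a path has passed an `ε` it
passes only `ε`'s. The vertex `[r]` is the one where it turns from `η`'s to `ε`'s, and the
dimensions of all letters are then forced. -/
theorem exists_letters_eq_of_normal {a b : Vertex} (x : Quiver.Path a b)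
    (h : Normal (pathLetters x)) :
    ∃ r I J, I.IsChain (· > ·) ∧ J.IsChain (· < ·) ∧ a.dim = r + J.length ∧
      b.dim = r + I.length ∧ pathLetters x = faceLetters b.dim I ++ degenLetters r J := by
  induction x with
  | nil => exact ⟨a.dim, [], [], .nil, .nil, rfl, rfl, rfl⟩
  | cons x e ih =>
    obtain ⟨r, I, J, hI, hJ, ha, hb, hx⟩ := ih h.tail
    change Edge _ _ at e
    simp only [pathLetters, hx] at h ⊢
    cases e with
    | face p i =>
      refine ⟨r, i :: I, J, ?_, hJ, ha, by simp at hb ⊢; omega, by simp [faceLetters, Edge.letter]⟩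
      cases I with
      | nil => exact .singleton _
      | cons i' I =>
        have := (List.isChain_cons_cons.1 h).1
        exact .cons_cons (by simpa [Letter.Reducible, Edge.letter] using this) hI
    | degen q j =>
      cases I with
      | cons i' I => exact ((List.isChain_cons_cons.1 h).1 trivial).elim
      | nil =>
        obtain rfl : q + 1 = r := hb
        refine ⟨q, [], j :: J, .nil, ?_, by simp at ha ⊢; omega, rfl,
          by simp [faceLetters, degenLetters, Edge.letter]⟩
        cases J with
        | nil => exact .singleton _
        | cons j' J =>
          have := (List.isChain_cons_cons.1 h).1
          exact .cons_cons (by simpa [Letter.Reducible, Edge.letter] using this) hJ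

/-- Turns the uniform bound `j_t < q` of the normal forms into the individual bounds that make each
`η` an actual edge. -/
theorem add_length_lt_of_isChain {j q : ℕ} {J : List ℕ} (hJ : (j :: J).IsChain (· < ·))
    (hq : ∀ t ∈ j :: J, t < q) : j + J.length < q := by
  induction J generalizing j with
  | nil => simpa using hq
  | cons j' J ih =>
    have := ih hJ.tail fun t ht => hq t (List.mem_cons_of_mem _ ht)
    have := (List.isChain_cons_cons.1 hJ).1
    simp only [List.length_cons]
    omega

theorem exists_letters_eq_degenLetters {J : List ℕ} {q r : ℕ} (hq : q = r + J.length)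
    (hJ : J.IsChain (· < ·)) (hJq : ∀ t ∈ J, t < q) :
    ∃ x : obj q ⟶ obj r, letters x = degenLetters r J := by
  induction J generalizing r with
  | nil => obtain rfl : q = r := hq; exact ⟨𝟙 _, rfl⟩
  | cons j J ih =>
    have hj := add_length_lt_of_isChain hJ hJq
    simp only [List.length_cons] at hq
    obtain ⟨x, hx⟩ := ih (r := r + 1) (by omega) hJ.tail fun t ht => hJq t (List.mem_cons_of_mem _ ht)
    exact ⟨x ≫ eta r ⟨j, by omega⟩, by simp [hx, degenLetters]⟩

theorem exists_letters_eq_faceLetters_append {q r : ℕ} (y : obj q ⟶ obj r) {I : List ℕ} {p : ℕ}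
    (hp : p = r + I.length) (hI : I.IsChain (· > ·)) (hIp : ∀ t ∈ I, t ≤ p) :
    ∃ x : obj q ⟶ obj p, letters x = faceLetters p I ++ letters y := by
  induction I generalizing p with
  | nil => obtain rfl : p = r := hp; exact ⟨y, rfl⟩
  | cons i I ih =>
    obtain rfl : p = r + I.length + 1 := hp
    have hi := hIp i (by simp)
    have hlt : ∀ t ∈ I, t < i := (List.pairwise_cons.1 (List.isChain_iff_pairwise.1 hI)).1
    obtain ⟨x, hx⟩ := ih rfl hI.tail fun t ht => by have := hlt t ht; omega
    exact ⟨x ≫ eps _ ⟨i, by omega⟩, by simp [hx, faceLetters]⟩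

theorem image_letters_normal (q p : ℕ) :
    letters '' {x : obj q ⟶ obj p | Normal (letters x)} = normalForms q p := by
  ext L
  constructor
  · rintro ⟨x, hx, rfl⟩
    obtain ⟨r, I, J, hI, hJ, hq, hp, h⟩ :=
      exists_letters_eq_of_normal (a := obj q) (b := obj p) x hx
    have hv := valid_of_mem_pathLetters (a := obj q) (b := obj p) x
    rw [h] at hv
    change q = _ at hq
    change p = _ at hp
    change letters x = faceLetters p I ++ _ at h
    change ∀ c ∈ faceLetters p I ++ _, _ at hv
    rw [faceLetters_eq_ofFn, degenLetters_eq_ofFn] at h hv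
    refine ⟨r, I.length, J.length, I.get, J.get, hq, hp, ?_, ?_, ?_, ?_, ?_⟩
    · exact (List.sortedGT_iff_strictAnti_get.1 hI.sortedGT)
    · intro t
      have := hv (.face (p - t) (I.get t)) (List.mem_append_left _ (List.mem_ofFn.2 ⟨t, rfl⟩))
      -- The letter gives the sharper bound `p - t`; conversely, strict decrease recovers it from
      -- `p`.
      exact le_trans this (Nat.sub_le _ _)
    · exact (List.sortedLT_iff_strictMono_get.1 hJ.sortedLT)
    · intro t
      have := hv (.degen (r + t) (J.get t)) (List.mem_append_right _ (List.mem_ofFn.2 ⟨t, rfl⟩))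
      have h' : J.get t ≤ r + t := this
      omega
    · obtain rfl : r = q - J.length := by omega
      exact h
  · rintro ⟨r, m, n, i, j, hq, hp, hi, hip, hj, hjq, rfl⟩
    have hI : (List.ofFn i).IsChain (· > ·) := by
      have := (List.sortedGT_ofFn_iff).2 hi
      exact this.isChain
    have hJ : (List.ofFn j).IsChain (· < ·) := by
      have := (List.sortedLT_ofFn_iff).2 hj
      exact this.isChain
    obtain ⟨y, hy⟩ := exists_letters_eq_degenLetters (J := List.ofFn j) (q := q) (r := r)
      (by simpa using hq) hJ (by simpa [List.mem_ofFn] using hjq)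
    obtain ⟨x, hx⟩ := exists_letters_eq_faceLetters_append y (I := List.ofFn i) (p := p)
      (by simpa using hp) hI (by simpa [List.mem_ofFn] using hip)
    rw [hy] at hx
    refine ⟨x, ?_, ?_⟩
    · rw [Set.mem_ofPred_eq, hx]
      exact normal_faceLetters_append_degenLetters hI hJ _ _
    · obtain rfl : r = q - n := by omega
      rw [hx, faceLetters_eq_ofFn, degenLetters_eq_ofFn]
      congr 1
      · apply List.ext_getElem <;> simp
      · apply List.ext_getElem <;> simp

/-! ### Irreducible words are separated by their actions -/

theorem act_degenLetters_surjective (r : ℕ) (J : List ℕ) :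
    Function.Surjective (act (degenLetters r J)) := by
  induction J generalizing r with
  | nil => exact Function.surjective_id
  | cons j J ih =>
    refine Function.Surjective.comp (fun n => ?_) (ih (r + 1))
    by_cases h : n ≤ j
    · exact ⟨n, by simp [Letter.act, h]⟩
    · exact ⟨n + 1, by simp [Letter.act]; omega⟩

theorem act_faceLetters_injective (p : ℕ) (I : List ℕ) :
    Function.Injective (act (faceLetters p I)) := by
  induction I generalizing p with
  | nil => exact Function.injective_id
  | cons i I ih =>
    refine Function.Injective.comp (fun n m h => ?_) (ih (p - 1))
    simp only [Letter.act] at h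
    split_ifs at h <;> omega

/-- The leftmost `ε^i` acts last and has the largest index: it adds the gap `i` and leaves the gaps
below `i` where they are. -/
theorem mem_range_act_iff (p r : ℕ) {I : List ℕ} (hI : I.IsChain (· > ·)) (J : List ℕ) (n : ℕ) :
    n ∈ Set.range (act (faceLetters p I ++ degenLetters r J)) ↔ n ∉ I := by
  induction I generalizing p n with
  | nil => simpa [faceLetters] using act_degenLetters_surjective r J n
  | cons i I ih =>
    have hlt : ∀ t ∈ I, t < i := (List.pairwise_cons.1 (List.isChain_iff_pairwise.1 hI)).1
    have ih := ih (p - 1) hI.tail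
    simp only [faceLetters, List.cons_append, act, Set.range_comp, Set.mem_image, ih,
      List.mem_cons, not_or]
    constructor
    · rintro ⟨m, hm, rfl⟩
      simp only [Letter.act]
      split_ifs with h
      · exact ⟨by omega, hm⟩
      · exact ⟨by omega, fun h' => by have := hlt _ h'; omega⟩
    · rintro ⟨hn, hnI⟩
      by_cases h : n < i
      · exact ⟨n, hnI, by simp [Letter.act, h]⟩
      · refine ⟨n - 1, fun h' => by have := hlt _ h'; omega, ?_⟩
        simp only [Letter.act]
        rw [if_neg (by omega)]
        omega

theorem degenLetters_append (r : ℕ) (J J' : List ℕ) :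
    degenLetters r (J ++ J') = degenLetters r J ++ degenLetters (r + J.length) J' := by
  induction J generalizing r with
  | nil => rfl
  | cons j J ih => simp [degenLetters, ih, Nat.add_assoc, Nat.add_comm 1]

/-- Induction from the right end, since the last letter `η^j` acts first and has the largest index.
Below `j` it changes nothing, at `j` it identifies `n` with `n + 1`, and above `j` it shifts both
down to values at least `j`, where the remaining letters identify no neighbours. -/
theorem act_degenLetters_eq_succ_iff (r : ℕ) {J : List ℕ} (hJ : J.Pairwise (· < ·)) (n : ℕ) :
    act (degenLetters r J) n = act (degenLetters r J) (n + 1) ↔ n ∈ J := by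
  induction J using List.reverseRecOn generalizing n with
  | nil => simp [degenLetters, act]
  | append_singleton J j ih =>
    rw [List.pairwise_append] at hJ
    have hlt : ∀ t ∈ J, t < j := fun t ht => hJ.2.2 t ht j (by simp)
    have ih := ih hJ.1
    simp only [degenLetters_append, act_append, degenLetters, act, Function.comp_apply, id,
      Letter.act, List.mem_append, List.mem_singleton]
    rcases lt_trichotomy n j with h | rfl | h
    · rw [if_pos h.le, if_pos (Nat.succ_le_of_lt h), ih]
      simp [h.ne]
    · simp
    · rw [if_neg (by omega), if_neg (by omega)]
      have := ih (n - 1)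
      rw [Nat.sub_add_cancel (by omega)] at this
      rw [Nat.add_sub_cancel, this]
      constructor
      · intro h'
        have := hlt _ h'
        omega
      · rintro (h' | rfl)
        · have := hlt _ h'
          omega
        · omega

theorem eq_of_act_letters_eq {a b : Paths Vertex} {x y : a ⟶ b} (hx : Normal (letters x))
    (hy : Normal (letters y)) (h : act (letters x) = act (letters y)) : x = y := by
  obtain ⟨r, I, J, hI, hJ, ha, hb, hxl⟩ := exists_letters_eq_of_normal (a := a) (b := b) x hx
  obtain ⟨r', I', J', hI', hJ', ha', hb', hyl⟩ := exists_letters_eq_of_normal (a := a) (b := b) y hy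
  apply letters_injective
  change letters x = _ at hxl
  change letters y = _ at hyl
  rw [hxl, hyl] at h ⊢
  obtain rfl : I = I' := by
    refine hI.sortedGT.eq_of_mem_iff hI'.sortedGT fun n => ?_
    rw [← not_iff_not, ← mem_range_act_iff _ r hI J, h, mem_range_act_iff _ _ hI']
  obtain rfl : J = J' := by
    -- The `ε` parts now agree and act injectively, so they cancel on the left.
    rw [act_append, act_append] at h
    have h := (act_faceLetters_injective _ _).comp_left h
    refine hJ.sortedLT.eq_of_mem_iff hJ'.sortedLT fun n => ?_
    rw [← act_degenLetters_eq_succ_iff r hJ.sortedLT.pairwise, h,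
      act_degenLetters_eq_succ_iff r' hJ'.sortedLT.pairwise]
  -- The action ignores dimensions; the common source supplies the missing one.
  obtain rfl : r = r' := by omega
  rfl

/-! ### Reduction modulo the relations -/

section Reduction

variable {k : Type w} [Field k]

theorem coeff_mono_sub_mono {a b : Paths Vertex} (x y z : a ⟶ b) [Decidable (x = z)]
    [Decidable (y = z)] :
    coeff (mono k x - mono k y) z = (if x = z then 1 else 0) - (if y = z then 1 else 0) := by
  refine (Finsupp.sub_apply (Finsupp.single x 1) (Finsupp.single y (1 : k)) z).trans ?_
  rw [Finsupp.single_apply, Finsupp.single_apply]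

theorem coeff_relPoly_self {a b : Paths Vertex} {x y : a ⟶ b} (h : Rel x y) :
    coeff (mono k x - mono k y) x = 1 := by
  classical
  have hne : y ≠ x := by
    rintro rfl
    exact irrefl_of simplicialLT _ (simplicialLT_of_rel h)
  rw [coeff_mono_sub_mono, if_pos rfl, if_neg hne, sub_zero]

theorem isLeading_relPoly_iff {a b : Paths Vertex} {x y l : a ⟶ b} (h : Rel x y) :
    IsLeading simplicialLT (mono k x - mono k y) l ↔ l = x := by
  classical
  have hlt := simplicialLT_of_rel h
  have hx := coeff_relPoly_self (k := k) h
  have heq : ∀ z, coeff (mono k x - mono k y) z ≠ 0 → z = x ∨ z = y := by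
    intro z hz
    rw [coeff_mono_sub_mono] at hz
    by_contra! hne
    simp [hne.1.symm, hne.2.symm] at hz
  constructor
  · rintro ⟨hl, hmax⟩
    rcases heq l hl with rfl | rfl
    · rfl
    · by_contra hne
      exact asymm_of simplicialLT hlt (hmax x (hx ▸ one_ne_zero) (Ne.symm hne))
  · rintro rfl
    refine ⟨hx ▸ one_ne_zero, fun z hz hne => ?_⟩
    rcases heq z hz with rfl | rfl
    · exact (hne rfl).elim
    · exact hlt

theorem mem_irr_iff {a b : Paths Vertex} {z : a ⟶ b} :
    z ∈ Irr simplicialLT (relPoly k Rel) a b ↔ Normal (letters z) := by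
  rw [normal_letters_iff]
  constructor
  · rintro h _ ⟨c, d, f, m₁, m₂, g, hm⟩
    exact h ⟨c, d, _, m₁, f, g, ⟨m₁, m₂, hm, rfl⟩, (isLeading_relPoly_iff hm).2 rfl, rfl⟩
  · rintro h ⟨c, d, _, l, f, g, ⟨m₁, m₂, hm, rfl⟩, hl, rfl⟩
    rw [isLeading_relPoly_iff hm] at hl
    subst hl
    exact h _ (.intro c d f l m₂ g hm)

theorem mono_comp {a b c : Paths Vertex} (x : a ⟶ b) (y : b ⟶ c) :
    mono k (x ≫ y) = mono k x ≫ mono k y :=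
  (Free.embedding k (Paths Vertex)).map_comp x y

theorem mono_sub_mono_comp {a b c d : Paths Vertex} (f : a ⟶ c) (x y : c ⟶ d) (g : d ⟶ b) :
    mono k (f ≫ x ≫ g) - mono k (f ≫ y ≫ g) = mono k f ≫ (mono k x - mono k y) ≫ mono k g := by
  simp only [mono_comp, Preadditive.sub_comp, Preadditive.comp_sub]

theorem equivMod_trans {S : ∀ a b : Paths Vertex, Set (Poly k a b)} {W : Word Vertex}
    {a b : Paths Vertex} {p q r : Poly k a b} (h : EquivMod simplicialLT S W p q)
    (h' : EquivMod simplicialLT S W q r) : EquivMod simplicialLT S W p r := by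
  simpa [EquivMod] using Submodule.add_mem _ h h'

theorem equivMod_of_reflTransGen {W : Word Vertex} {a b : Paths Vertex} {x y : a ⟶ b}
    (h : Relation.ReflTransGen (@HomRel.CompClosure _ _ Rel a b) x y)
    (hx : simplicialLT (toWord x) W) :
    EquivMod simplicialLT (relPoly k Rel) W (mono k x) (mono k y) := by
  induction h using Relation.ReflTransGen.head_induction_on with
  | refl => rw [EquivMod, sub_self]; exact Submodule.zero_mem _
  | head h _ ih =>
    refine equivMod_trans ?_ (ih (trans_of simplicialLT (simplicialLT_of_compClosure h) hx))
    obtain ⟨c, d, f, m₁, m₂, g, hm⟩ := h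
    exact Submodule.subset_span ⟨c, d, _, m₁, f, g, ⟨m₁, m₂, hm, rfl⟩,
      (isLeading_relPoly_iff hm).2 rfl, hx, mono_sub_mono_comp f m₁ m₂ g⟩

/-- This replaces the case analysis of compositions: both words reduce to irreducible words with the
same action, hence to the same word, and every reduction step stays below `W`. -/
theorem equivMod_of_act_eq {W : Word Vertex} {a b : Paths Vertex} {x y : a ⟶ b}
    (hx : simplicialLT (toWord x) W) (hy : simplicialLT (toWord y) W)
    (h : act (letters x) = act (letters y)) :
    EquivMod simplicialLT (relPoly k Rel) W (mono k x - mono k y) 0 := by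
  obtain ⟨x', hx', hxx'⟩ := exists_normal_reflTransGen x
  obtain ⟨y', hy', hyy'⟩ := exists_normal_reflTransGen y
  obtain rfl : x' = y' := eq_of_act_letters_eq hx' hy' <| by
    rw [← act_letters_eq_of_reflTransGen hxx', ← act_letters_eq_of_reflTransGen hyy', h]
  have := Submodule.sub_mem _ (equivMod_of_reflTransGen (k := k) hxx' hx)
    (equivMod_of_reflTransGen (k := k) hyy' hy)
  rwa [sub_sub_sub_cancel_right, ← sub_zero (mono k x - mono k y)] at this

theorem isGroebnerShirshovBasis_relPoly :
    IsGroebnerShirshovBasis simplicialLT (relPoly k Rel) := by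
  refine ⟨⟨_, _, _, _, _, Rel.h_eq 0 0, rfl⟩, ?_, ?_, ?_⟩
  · rintro a b _ ⟨x, y, h, rfl⟩
    exact ⟨x, (isLeading_relPoly_iff h).2 rfl, coeff_relPoly_self h⟩
  · rintro a b c d _ _ lf lg f g ⟨x₁, y₁, h₁, rfl⟩ ⟨x₂, y₂, h₂, rfl⟩ hlf hlg h
    rw [isLeading_relPoly_iff h₁] at hlf
    rw [isLeading_relPoly_iff h₂] at hlg
    subst hlf hlg
    have hc : HomRel.CompClosure Rel lf (f ≫ y₂ ≫ g) := h ▸ .intro c d f lg y₂ g h₂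
    -- The leading words cancel and leave the two one-step reducts of `lf`.
    rw [← mono_sub_mono_comp, ← h, sub_sub_sub_cancel_left]
    refine equivMod_of_act_eq (simplicialLT_of_compClosure hc) (simplicialLT_of_rel h₁) ?_
    rw [← act_letters_eq_of_compClosure hc, act_letters_eq_of_rel h₁]
  · rintro a b c d _ _ lf lg f g ⟨x₁, y₁, h₁, rfl⟩ ⟨x₂, y₂, h₂, rfl⟩ hlf hlg h
    rw [isLeading_relPoly_iff h₁] at hlf
    rw [isLeading_relPoly_iff h₂] at hlg
    subst hlf hlg
    have hc₁ : HomRel.CompClosure Rel (f ≫ lf) (f ≫ y₁) :=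
      HomRel.IsStableUnderPrecomp.comp_left f (.of h₁)
    have hc₂ : HomRel.CompClosure Rel (f ≫ lf) (y₂ ≫ g) :=
      h ▸ HomRel.IsStableUnderPostcomp.comp_right g (.of h₂)
    rw [Preadditive.comp_sub, Preadditive.sub_comp, ← mono_comp, ← mono_comp, ← mono_comp,
      ← mono_comp, ← h, sub_sub_sub_cancel_left]
    refine equivMod_of_act_eq (simplicialLT_of_compClosure hc₂) (simplicialLT_of_compClosure hc₁) ?_
    rw [← act_letters_eq_of_compClosure hc₁, ← act_letters_eq_of_compClosure hc₂]

/-! ### Linear bases -/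

theorem span_mono_eq_top {C : Type u} [Category.{v} C] (a b : C) :
    Submodule.span k (Set.range fun x : a ⟶ b => mono k x) = ⊤ := by
  refine Eq.trans ?_ (Finsupp.basisSingleOne (R := k) (ι := a ⟶ b)).span_eq
  rw [Finsupp.coe_basisSingleOne]
  rfl

/-- The action of a word, as an element of the monoid of self-maps of `ℕ`. -/
def actEnd {a b : Paths Vertex} (x : a ⟶ b) : Function.End ℕ := act (letters x)

theorem actEnd_comp {a b c : Paths Vertex} (x : a ⟶ b) (y : b ⟶ c) :
    actEnd (x ≫ y) = actEnd y * actEnd x := by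
  rw [actEnd, letters_comp, act_append]
  rfl

/-- The linear extension of the action of words. -/
noncomputable def actMap (k : Type w) [Field k] (a b : Paths Vertex) :
    Poly k a b →ₗ[k] MonoidAlgebra k (Function.End ℕ) :=
  Finsupp.linearCombination k fun x : a ⟶ b => MonoidAlgebra.single (actEnd x) (1 : k)

theorem actMap_mono {a b : Paths Vertex} (x : a ⟶ b) :
    actMap k a b (mono k x) = MonoidAlgebra.single (actEnd x) (1 : k) := by
  refine (Finsupp.linearCombination_single k _ _).trans ?_
  rw [one_smul]

theorem actMap_comp {a b c : Paths Vertex} (f : Poly k a b) (g : Poly k b c) :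
    actMap k a c (f ≫ g) = actMap k b c g * actMap k a b f := by
  have hf : f ∈ Submodule.span k (Set.range fun x : a ⟶ b => mono k x) := by
    rw [span_mono_eq_top]; trivial
  have hg : g ∈ Submodule.span k (Set.range fun x : b ⟶ c => mono k x) := by
    rw [span_mono_eq_top]; trivial
  induction hf using Submodule.span_induction with
  | zero => simp
  | add f₁ f₂ _ _ h₁ h₂ => simp [Preadditive.add_comp, mul_add, h₁, h₂]
  | smul r f _ h => simp [Linear.smul_comp, h]
  | mem f hf =>
    obtain ⟨x, rfl⟩ := hf
    induction hg using Submodule.span_induction with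
    | zero => simp only [Limits.comp_zero, map_zero, zero_mul]
    | add g₁ g₂ _ _ h₁ h₂ => simp only [Preadditive.comp_add, map_add, add_mul, h₁, h₂]
    | smul r g _ h => simp only [Linear.comp_smul, map_smul, h, smul_mul_assoc]
    | mem g hg =>
      obtain ⟨y, rfl⟩ := hg
      rw [← mono_comp, actMap_mono, actMap_mono, actMap_mono, MonoidAlgebra.single_mul_single,
        actEnd_comp, one_mul]

/-- Since `actMap` turns composition into multiplication, its kernels form an ideal, and this ideal
contains the relations. -/
theorem idealGen_le_ker_actMap (a b : Paths Vertex) :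
    idealGen (relPoly k Rel) a b ≤ LinearMap.ker (actMap k a b) := by
  refine iInf_le_of_le (fun a b => LinearMap.ker (actMap k a b)) (iInf_le_of_le ⟨?_, ?_⟩
    (iInf_le_of_le ?_ le_rfl))
  · intro a b c f g hf
    rw [LinearMap.mem_ker] at hf ⊢
    rw [actMap_comp, hf, mul_zero]
  · intro a b c f g hg
    rw [LinearMap.mem_ker] at hg ⊢
    rw [actMap_comp, hg, zero_mul]
  · rintro a b _ ⟨x, y, h, rfl⟩
    change actMap k a b (mono k x - mono k y) = 0
    rw [map_sub, actMap_mono, actMap_mono, actEnd, actEnd, act_letters_eq_of_rel h, sub_self]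

theorem mono_sub_mono_mem_idealGen {a b : Paths Vertex} {x y : a ⟶ b}
    (h : HomRel.CompClosure Rel x y) : mono k x - mono k y ∈ idealGen (relPoly k Rel) a b := by
  obtain ⟨c, d, f, m₁, m₂, g, hm⟩ := h
  simp only [idealGen, Submodule.mem_iInf]
  intro I hI hS
  rw [mono_sub_mono_comp]
  exact hI.2 _ _ _ _ _ (hI.1 _ _ _ _ _ (hS _ _ ⟨m₁, m₂, hm, rfl⟩))

theorem mkQ_mono_eq_of_reflTransGen {a b : Paths Vertex} {x y : a ⟶ b}
    (h : Relation.ReflTransGen (@HomRel.CompClosure _ _ Rel a b) x y) :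
    (idealGen (relPoly k Rel) a b).mkQ (mono k x) =
      (idealGen (relPoly k Rel) a b).mkQ (mono k y) := by
  induction h with
  | refl => rfl
  | tail _ h ih =>
    exact ih.trans ((Submodule.Quotient.eq _).2 (mono_sub_mono_mem_idealGen h))

theorem functor_map_eq_of_reflTransGen {a b : Paths Vertex} {x y : a ⟶ b}
    (h : Relation.ReflTransGen (@HomRel.CompClosure _ _ Rel a b) x y) :
    (Quotient.functor Rel).map x = (Quotient.functor Rel).map y := by
  induction h with
  | refl => rfl
  | tail _ h ih => exact ih.trans (Quot.sound h)

theorem act_letters_eq_of_functor_map_eq {a b : Paths Vertex} {x y : a ⟶ b}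
    (h : (Quotient.functor Rel).map x = (Quotient.functor Rel).map y) :
    act (letters x) = act (letters y) :=
  congrArg (Quot.lift (r := @HomRel.CompClosure _ _ Rel a b) (fun x => act (letters x))
    fun _ _ h => act_letters_eq_of_compClosure h) h

theorem linearIndependent_mono {C : Type u} [Category.{v} C] (a b : C) :
    LinearIndependent k (fun x : a ⟶ b => mono k x) := by
  have := (Finsupp.basisSingleOne (R := k) (ι := a ⟶ b)).linearIndependent
  rw [Finsupp.coe_basisSingleOne] at this
  exact this

theorem isLinearBasis_mkQ (a b : Paths Vertex) :
    IsLinearBasis (k := k) (Irr simplicialLT (relPoly k Rel) a b)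
      (fun x => (idealGen (relPoly k Rel) a b).mkQ (mono k x)) := by
  constructor
  · refine LinearIndependent.of_comp
      ((idealGen (relPoly k Rel) a b).liftQ (actMap k a b) (idealGen_le_ker_actMap a b)) ?_
    have hinj : Function.Injective fun x : Irr simplicialLT (relPoly k Rel) a b =>
        actEnd (x : a ⟶ b) := fun x y h =>
      Subtype.ext (eq_of_act_letters_eq (mem_irr_iff.1 x.2) (mem_irr_iff.1 y.2) h)
    -- It remains to see that distinct self-maps of `ℕ` are independent in the monoid algebra, which
    -- is read off from coefficients.
    refine LinearIndependent.of_comp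
      (MonoidAlgebra.coeffLinearEquiv k : MonoidAlgebra k (Function.End ℕ) ≃ₗ[k] _).toLinearMap ?_
    convert (Finsupp.linearIndependent_single_one k (Function.End ℕ)).comp _ hinj using 1
    funext x
    change MonoidAlgebra.coeff (actMap k a b (mono k (x : a ⟶ b))) = _
    rw [actMap_mono]
    rfl
  · have h := congrArg (Submodule.map (idealGen (relPoly k Rel) a b).mkQ)
      (span_mono_eq_top (k := k) a b)
    rw [Submodule.map_top, Submodule.range_mkQ, Submodule.map_span] at h
    rw [eq_top_iff, ← h, Submodule.span_le]
    rintro _ ⟨_, ⟨x, rfl⟩, rfl⟩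
    obtain ⟨z, hz, hxz⟩ := exists_normal_reflTransGen x
    exact Submodule.subset_span ⟨z, mem_irr_iff.2 hz, (mkQ_mono_eq_of_reflTransGen hxz).symm⟩

/-- The morphisms of `C(X|S)` already form a basis of its partial algebra, so it suffices that each
has exactly one irreducible representative: existence by termination, uniqueness because the action
descends to classes. -/
theorem isLinearBasis_functor_map (a b : Paths Vertex) :
    IsLinearBasis (k := k) (Irr simplicialLT (relPoly k Rel) a b)
      (fun x => mono k ((Quotient.functor Rel).map x)) := by
  constructor
  · have hinj : Function.Injective fun x : Irr simplicialLT (relPoly k Rel) a b =>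
        (Quotient.functor Rel).map (x : a ⟶ b) := fun x y h =>
      Subtype.ext (eq_of_act_letters_eq (mem_irr_iff.1 x.2) (mem_irr_iff.1 y.2)
        (act_letters_eq_of_functor_map_eq h))
    exact (linearIndependent_mono _ _).comp _ hinj
  · rw [eq_top_iff, ← span_mono_eq_top, Submodule.span_le]
    rintro _ ⟨y, rfl⟩
    obtain ⟨x, rfl⟩ := (Quotient.functor Rel).map_surjective y
    obtain ⟨z, hz, hxz⟩ := exists_normal_reflTransGen x
    exact Submodule.subset_span ⟨z, mem_irr_iff.2 hz,
      congrArg (mono k) (functor_map_eq_of_reflTransGen hxz).symm⟩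

end Reduction

end GSCat

theorem mainTheorem2 (k : Type w) [Field k] :
    IsMonomialOrder simplicialLT ∧
    IsGroebnerShirshovBasis simplicialLT (relPoly k Rel) ∧
    (∀ q p : ℕ,
      letters '' Irr simplicialLT (relPoly k Rel) (obj q) (obj p) = normalForms q p) ∧
    (∀ a b : Paths Vertex,
      IsLinearBasis (k := k) (Irr simplicialLT (relPoly k Rel) a b)
        (fun x => (idealGen (relPoly k Rel) a b).mkQ (mono k x))) ∧
    (∀ a b : Paths Vertex,
      IsLinearBasis (k := k) (Irr simplicialLT (relPoly k Rel) a b)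
        (fun x => mono k ((Quotient.functor Rel).map x))) := by
  refine ⟨simplicialLT_isMonomialOrder, isGroebnerShirshovBasis_relPoly, fun q p => ?_,
    isLinearBasis_mkQ, isLinearBasis_functor_map⟩
  rw [← image_letters_normal]
  congr 1
  ext x
  exact mem_irr_iff
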